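/- Let $m,r\ge 0$ and $k\ge 1$ be integers and let $\beta=(\beta_1,\dots,\beta_m)$ be a sequence of non-negative integers. Let $\mathcal{OP}^{\mathrm{all}}_{r;\beta,k}$ be the set of ordered multiset partitions $B_1/\cdots/B_k$ of the multiset $\{0^r,1^{\beta_1},\dots,m^{\beta_m}\}$ into $k$ nonempty blocks, where no block contains a repeated element, and let $\mathcal{OP}_{r;\beta,k}$ be the subset of those with $0\notin B_k$. (For $k=0$, $\mathcal{OP}^{\mathrm{all}}_{r;\beta,0}$ consists of the empty partition if $r=0$ and $\beta=0$, and is empty otherwise.) For $\pi=B_1/\cdots/B_k$, let $\mathrm{miniword}(\pi)$ be the word obtained as follows: write $B_k$ in increasing order; then, for $i=k-1,\dots,1$, write to the left of the word already built first the elements of $B_i$ strictly larger than the first letter of that word, in increasing order, and then the remaining elements of $B_i$, in increasing order. For a word $w=w_1w_2\cdots$ let $\mathrm{maj}(w)=\sum_{i:\,w_i>w_{i+1}} i$, and put $\mathrm{minimaj}(\pi)=\mathrm{maj}(\mathrm{miniword}(\pi))$. Let $\mathrm{inv}(\pi)$ be the number of pairs of entries $a>b$ of $\pi$ such that $b$ is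 the minimum of its block and $a$ lies in a block strictly to the left of the block of $b$. Put $$M_{r;\beta,k}(q)=\sum_{\pi\in\mathcal{OP}_{r;\beta,k}}q^{\mathrm{minimaj}(\pi)},\quad M^{\mathrm{all}}_{r;\beta,k}(q)=\sum_{\pi\in\mathcal{OP}^{\mathrm{all}}_{r;\beta,k}}q^{\mathrm{minimaj}(\pi)},$$ and define $I_{r;\beta,k}(q)$ and $I^{\mathrm{all}}_{r;\beta,k}(q)$ in the same way with $\mathrm{inv}$ in place of $\mathrm{minimaj}$. For $S\subseteq[m]=\{1,\dots,m\}$ let $\chi_S\in\{0,1\}^m$ be its indicator sequence; $\chi_S\le\beta$ is meant entrywise. **Theorem.** The generating function of minimaj satisfies $$M_{r;\beta,k}(q)=\sum_{\substack{\emptyset\ne S\subseteq[m]\\ \chi_S\le\beta}} q^{\sum_{i=\min(S)+1}^{m}(\beta_i-\chi_S(i))}\,M^{\mathrm{all}}_{r;\beta-\chi_S,k-1}(q),$$ and the generating function of inv satisfies the same recursion: $$I_{r;\beta,k}(q)=\sum_{\substack{\emptyset\ne S\subseteq[m]\\ \chi_S\le\beta}} q^{\sum_{i=\min(S)+1}^{m}(\beta_i-\chi_S(i))}\,I^{\mathrm{all}}_{r;\beta-\chi_S,k-1}(q).$$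 -/

import Mathlib

open Polynomial

namespace OMP

/-- The multiset `A(β) ∪ {0^r}`. The alphabet is `{0, 1, …, m} = Fin (m + 1)`;
the entry `β i`, for `i : Fin m`, is the multiplicity of the letter `i.succ`. -/
def multisetA {m : ℕ} (r : ℕ) (β : Fin m → ℕ) : Multiset (Fin (m + 1)) :=
  Multiset.replicate r 0 + ∑ i : Fin m, Multiset.replicate (β i) i.succ

/-- `π` lists the blocks of an ordered multiset partition of `A(β) ∪ {0^r}` into `k`
(nonempty, repetition-free) blocks; `0` may occur in any block. -/
def IsPartitionAll {m k : ℕ} (r : ℕ) (β : Fin m → ℕ) (π : Fin k → Finset (Fin (m + 1))) : Prop :=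
  (∀ i, (π i).Nonempty) ∧ ∑ i, (π i).val = multisetA r β

/-- Extended ordered multiset partitions: `0` does not occur in the last block. -/
def IsPartition {m k : ℕ} (r : ℕ) (β : Fin m → ℕ) (π : Fin k → Finset (Fin (m + 1))) : Prop :=
  IsPartitionAll r β π ∧ ∀ i : Fin k, i.val + 1 = k → 0 ∉ π i

instance {m k : ℕ} (r : ℕ) (β : Fin m → ℕ) :
    DecidablePred (IsPartitionAll (k := k) r β) := fun π => by
  unfold IsPartitionAll
  infer_instance

instance {m k : ℕ} (r : ℕ) (β : Fin m → ℕ) :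
    DecidablePred (IsPartition (k := k) r β) := fun π => by
  unfold IsPartition
  infer_instance

/-- The word obtained by organizing the blocks of a list of blocks from right to left: the last
block is written increasingly; any other block is written as its letters that are strictly bigger
than the first letter `a` of the word formed by the later blocks, increasingly, followed by its
remaining letters, increasingly. -/
def miniwordList {n : ℕ} : List (Finset (Fin n)) → List (Fin n)
  | [] => []
  | B :: rest =>
    match miniwordList rest with
    | [] => B.sort (· ≤ ·)
    | a :: w =>
      (B.filter (fun x => a < x)).sort (· ≤ ·) ++ (B.filter (fun x => x ≤ a)).sort (· ≤ ·) ++ a :: w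

def miniword {n k : ℕ} (π : Fin k → Finset (Fin n)) : List (Fin n) :=
  miniwordList (List.ofFn π)

/-- The major index of a word `w₁ w₂ ⋯`: the sum of the positions `i` (counted from `1`) with
`w_i > w_{i+1}`. -/
def majWord {n : ℕ} (w : List (Fin n)) : ℕ :=
  ∑ i : Fin (w.length - 1),
    if w.get ⟨i.val + 1, by omega⟩ < w.get ⟨i.val, by omega⟩ then i.val + 1 else 0

def minimaj {n k : ℕ} (π : Fin k → Finset (Fin n)) : ℕ :=
  majWord (miniword π)

/-- The number of inversion pairs: pairs of entries `a > b` (`a` in block `i`, `b` in block `j`)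
such that `b` is the minimum of its block and `a` lies in a block strictly to the left. -/
def inv {n k : ℕ} (π : Fin k → Finset (Fin n)) : ℕ :=
  (Finset.univ.filter (fun p : (Fin k × Fin n) × (Fin k × Fin n) =>
    p.1.1 < p.2.1 ∧ p.1.2 ∈ π p.1.1 ∧ (π p.2.1).min = p.2.2 ∧ p.2.2 < p.1.2)).card

/-- The generating function `M_{r;β,k}(q)`. -/
noncomputable def M {m : ℕ} (r : ℕ) (β : Fin m → ℕ) (k : ℕ) : ℕ[X] :=
  ∑ π : Fin k → Finset (Fin (m + 1)) with IsPartition r β π, X ^ minimaj π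

/-- The generating function of minimaj where `0` is allowed in the last block. -/
noncomputable def Mall {m : ℕ} (r : ℕ) (β : Fin m → ℕ) (k : ℕ) : ℕ[X] :=
  ∑ π : Fin k → Finset (Fin (m + 1)) with IsPartitionAll r β π, X ^ minimaj π

/-- The generating function `I_{r;β,k}(q)`. -/
noncomputable def I {m : ℕ} (r : ℕ) (β : Fin m → ℕ) (k : ℕ) : ℕ[X] :=
  ∑ π : Fin k → Finset (Fin (m + 1)) with IsPartition r β π, X ^ inv π

/-- The generating function of inv where `0` is allowed in the last block. -/
noncomputable def Iall {m : ℕ} (r : ℕ) (β : Fin m → ℕ) (k : ℕ) : ℕ[X] :=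
  ∑ π : Fin k → Finset (Fin (m + 1)) with IsPartitionAll r β π, X ^ inv π

/-- The indicator sequence `χ_S`. -/
def chi {m : ℕ} (S : Finset (Fin m)) : Fin m → ℕ := fun i => if i ∈ S then 1 else 0

/-- The exponent `∑_{i > min S} (β_i - χ_S(i))`. -/
def lastBlockExponent {m : ℕ} (β : Fin m → ℕ) (S : Finset (Fin m)) : ℕ :=
  ∑ i ∈ Finset.univ.filter (fun i : Fin m => S.min < WithTop.some i), (β i - chi S i)

end OMP

/-! Treat `0` as an ordinary letter of multiplicity `r` and delete the last block `S`, with minimum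
`a`. For inv this is immediate: `S` adds one pair for each earlier entry larger than `a`
(`inv_snoc`). For minimaj the same number splits off, but what remains is minimaj of the other
blocks after the cyclic relabelling `x ↦ x - (a + 1)` of the alphabet (`minimaj_snoc`). The
recursion thus follows once the generating function over all partitions is invariant under rotating
the multiplicities.

In fact it is fully symmetric. By induction on `k`, rotation invariance for `k` blocks gives the
recursion for `k + 1` blocks, so the generating function is an iterate of the operator `removeBlock`
(`map_minimajGen`). This operator preserves a three-term relation between adjacent multiplicities
(`Contiguous.removeBlock`), and the relation forces symmetry (`Contiguous.perm`). Coefficients are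
in `ℤ` there to allow subtraction. -/

namespace OMP

/-! ### Lowering operators and the contiguity relation -/

/-- Sum over all ways of lowering some of the entries of a list by one, weighted by the sum of the
resulting entries. -/
noncomputable def lowerSum : (List ℕ → ℤ[X]) → List ℕ → ℤ[X]
  | f, [] => f []
  | f, 0 :: l => lowerSum (fun t => f (0 :: t)) l
  | f, (a + 1) :: l => X ^ (a + 1) * lowerSum (fun t => f ((a + 1) :: t)) l
      + X ^ a * lowerSum (fun t => f (a :: t)) l

/-- Sum over all ways of lowering at least one of the entries of a list by one, weighted by the sum
of the resulting entries to the right of the first lowered one. -/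
noncomputable def removeBlock : (List ℕ → ℤ[X]) → List ℕ → ℤ[X]
  | _, [] => 0
  | f, 0 :: l => removeBlock (fun t => f (0 :: t)) l
  | f, (a + 1) :: l => removeBlock (fun t => f ((a + 1) :: t)) l
      + lowerSum (fun t => f (a :: t)) l

theorem lowerSum_linear (c₁ c₂ c₃ : ℤ[X]) (l : List ℕ) :
    ∀ f₁ f₂ f₃ : List ℕ → ℤ[X], (∀ t, c₁ * f₁ t - c₂ * f₂ t = c₃ * f₃ t) →
      c₁ * lowerSum f₁ l - c₂ * lowerSum f₂ l = c₃ * lowerSum f₃ l := by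
  induction l with
  | nil => intro f₁ f₂ f₃ h; simpa [lowerSum] using h []
  | cons a l ih =>
    intro f₁ f₂ f₃ h
    cases a with
    | zero => exact ih _ _ _ fun t => h _
    | succ a =>
      have h₁ := ih _ _ _ fun t => h ((a + 1) :: t)
      have h₂ := ih _ _ _ fun t => h (a :: t)
      simp only [lowerSum]
      linear_combination X ^ (a + 1) * h₁ + X ^ a * h₂

theorem removeBlock_linear (c₁ c₂ c₃ : ℤ[X]) (l : List ℕ) :
    ∀ f₁ f₂ f₃ : List ℕ → ℤ[X], (∀ t, c₁ * f₁ t - c₂ * f₂ t = c₃ * f₃ t) →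
      c₁ * removeBlock f₁ l - c₂ * removeBlock f₂ l = c₃ * removeBlock f₃ l := by
  induction l with
  | nil => intro f₁ f₂ f₃ h; simp [removeBlock]
  | cons a l ih =>
    intro f₁ f₂ f₃ h
    cases a with
    | zero => exact ih _ _ _ fun t => h _
    | succ a =>
      have h₁ := ih _ _ _ fun t => h ((a + 1) :: t)
      have h₂ := lowerSum_linear c₁ c₂ c₃ l _ _ _ fun t => h (a :: t)
      simp only [removeBlock]
      linear_combination h₁ + h₂

/-- The contiguity relation between the values of `f` at lists that differ in two adjacent
entries. -/
def Contiguous (f : List ℕ → ℤ[X]) : Prop :=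
  ∀ (u v : List ℕ) (a b : ℕ),
    (X ^ (b + 1) - 1) * f (u ++ a :: (b + 1) :: v) - (X ^ (a + 1) - 1) * f (u ++ (a + 1) :: b :: v)
      = (X ^ a - X ^ b) * f (u ++ a :: b :: v)

theorem Contiguous.cons {f : List ℕ → ℤ[X]} (hf : Contiguous f) (c : ℕ) :
    Contiguous fun t => f (c :: t) :=
  fun u v a b => hf (c :: u) v a b

theorem Contiguous.lowerSum {f : List ℕ → ℤ[X]} (hf : Contiguous f) :
    Contiguous (lowerSum f) := by
  intro u
  induction u generalizing f with
  | nil =>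
    intro v a b
    have key (x y : ℕ) := lowerSum_linear (X ^ (y + 1) - 1) (X ^ (x + 1) - 1) (X ^ x - X ^ y) v
      _ _ _ (fun t => hf [] t x y)
    simp only [List.nil_append] at key ⊢
    have h₀ := key a b
    -- The relation at `(a, b)` combines those for `f` at `(a, b)`, `(a-1, b)`, `(a, b-1)`, `(a-1,
    -- b-1)` with weights `X^(a+b+1)`, `X^(a+b)`, `X^(a+b)`, `X^(a+b-1)`; those with a negative
    -- entry drop out.
    rcases a with _ | a <;> rcases b with _ | b <;> simp only [OMP.lowerSum, zero_add, pow_zero] at *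
    · linear_combination X * h₀
    · have h₁ := key 0 b
      simp only [zero_add, pow_zero] at h₁
      linear_combination X ^ (b + 2) * h₀ + X ^ (b + 1) * h₁
    · have h₁ := key a 0
      simp only [zero_add, pow_zero] at h₁
      linear_combination X ^ (a + 2) * h₀ + X ^ (a + 1) * h₁
    · have h₁ := key a (b + 1)
      have h₂ := key (a + 1) b
      have h₃ := key a b
      linear_combination X ^ (a + b + 3) * h₀ + X ^ (a + b + 2) * h₁ + X ^ (a + b + 2) * h₂
        + X ^ (a + b + 1) * h₃
  | cons c u ih =>
    intro v a b
    cases c with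
    | zero => exact ih (hf.cons 0) v a b
    | succ c =>
      have h₁ := ih (hf.cons (c + 1)) v a b
      have h₂ := ih (hf.cons c) v a b
      simp only [List.cons_append, OMP.lowerSum]
      linear_combination X ^ (c + 1) * h₁ + X ^ c * h₂

theorem Contiguous.removeBlock {f : List ℕ → ℤ[X]} (hf : Contiguous f) :
    Contiguous (removeBlock f) := by
  intro u
  induction u generalizing f with
  | nil =>
    intro v a b
    have key (x y : ℕ) := lowerSum_linear (X ^ (y + 1) - 1) (X ^ (x + 1) - 1) (X ^ x - X ^ y) v
      _ _ _ (fun t => hf [] t x y)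
    have h := removeBlock_linear (X ^ (b + 1) - 1) (X ^ (a + 1) - 1) (X ^ a - X ^ b) v
      _ _ _ (fun t => hf [] t a b)
    simp only [List.nil_append] at key h ⊢
    rcases a with _ | a <;> rcases b with _ | b <;>
      simp only [OMP.removeBlock, OMP.lowerSum, zero_add, pow_zero] at *
    · linear_combination h
    · have h₁ := key 0 b
      simp only [zero_add, pow_zero] at h₁
      linear_combination h + h₁
    · have h₁ := key a 0
      simp only [zero_add, pow_zero] at h₁
      linear_combination h + X * h₁
    · have h₁ := key a (b + 1)
      have h₂ := key (a + 1) b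
      have h₃ := key a b
      linear_combination h + X ^ (b + 2) * h₁ + h₂ + X ^ (b + 1) * h₃
  | cons c u ih =>
    intro v a b
    cases c with
    | zero => exact ih (hf.cons 0) v a b
    | succ c =>
      have h₁ := ih (hf.cons (c + 1)) v a b
      -- Once the first lowered entry is `c + 1`, the tail is governed by `lowerSum`, so its
      -- contiguity is needed too.
      have h₂ := (hf.cons c).lowerSum u v a b
      simp only [List.cons_append, OMP.removeBlock]
      linear_combination h₁ + h₂

/-! ### Contiguity implies symmetry -/

/-- With symmetry known on the previous antidiagonal, adding the recurrence at `(a, b)` and `(b, a)`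
cancels the right sides. Hence `s a b - s b a` is constant along the next antidiagonal; being
antisymmetric, it vanishes. -/
theorem symmetric_of_recurrence {R : Type*} [CommRing R] [NoZeroDivisors R] [CharZero R]
    (s c : ℕ → ℕ → R) (hc : ∀ a b, c a b = - c b a)
    (h : ∀ a b, s a (b + 1) - s (a + 1) b = c a b * s a b) (n : ℕ) :
    ∀ a b, a + b = n → s a b = s b a := by
  induction n with
  | zero => intro a b hab; obtain ⟨rfl, rfl⟩ : a = 0 ∧ b = 0 := by omega
            rfl
  | succ n ih =>
    have step (a b : ℕ) (hab : a + b = n) :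
        s a (b + 1) - s (b + 1) a = s (a + 1) b - s b (a + 1) := by
      have h₁ := h a b
      have h₂ := h b a
      rw [← ih a b hab, hc b a] at h₂
      linear_combination h₁ + h₂
    have const (a : ℕ) : ∀ b, a + b = n + 1 → s a b - s b a = s 0 (n + 1) - s (n + 1) 0 := by
      induction a with
      | zero => intro b hb; obtain rfl : b = n + 1 := by omega
                rfl
      | succ a iha =>
        intro b hb
        rw [← step a b (by omega)]
        exact iha (b + 1) (by omega)
    intro a b hab
    have h₁ := const a b hab
    have h₂ := const b a (by omega)
    have h₃ : (2 : R) * (s a b - s b a) = 0 := by linear_combination h₁ - h₂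
    rcases mul_eq_zero.1 h₃ with h | h
    · exact absurd h two_ne_zero
    · exact sub_eq_zero.1 h

theorem Contiguous.swap {f : List ℕ → ℤ[X]} (hf : Contiguous f) (a b : ℕ) (v : List ℕ) :
    f (a :: b :: v) = f (b :: a :: v) := by
  -- Multiplying by these `q`-factorials (up to sign and powers of `X - 1`) absorbs the coefficients
  -- on the left of the contiguity relation.
  let w (n : ℕ) : ℤ[X] := ∏ j ∈ Finset.range n, (X ^ (j + 1) - 1)
  have hw (n : ℕ) : w n ≠ 0 :=
    Finset.prod_ne_zero_iff.2 fun j _ => X_pow_sub_C_ne_zero (Nat.succ_pos j) (1 : ℤ)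
  have hs (n : ℕ) : w (n + 1) = w n * (X ^ (n + 1) - 1) := Finset.prod_range_succ _ _
  have h := symmetric_of_recurrence (fun a b => w a * w b * f (a :: b :: v))
    (fun a b => X ^ a - X ^ b) (fun a b => by ring)
    (fun a b => by
      have := hf [] v a b
      simp only [List.nil_append] at this
      simp only [hs]
      linear_combination w a * w b * this) (a + b) a b rfl
  have h' : w a * w b * f (a :: b :: v) = w b * w a * f (b :: a :: v) := h
  refine mul_left_cancel₀ (mul_ne_zero (hw a) (hw b)) ?_
  rw [h', mul_comm (w b)]

theorem Contiguous.perm {l₁ l₂ : List ℕ} (h : l₁.Perm l₂) :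
    ∀ {f : List ℕ → ℤ[X]}, Contiguous f → f l₁ = f l₂ := by
  induction h with
  | nil => intros; rfl
  | cons c _ ih => intro f hf; exact ih (hf.cons c)
  | swap a b v => intro f hf; exact hf.swap b a v
  | trans _ _ ih₁ ih₂ => intro f hf; exact (ih₁ hf).trans (ih₂ hf)

/-- The generating function obtained by removing `k` blocks one after the other. -/
noncomputable def iterGen : ℕ → List ℕ → ℤ[X]
  | 0 => fun l => if ∀ a ∈ l, a = 0 then 1 else 0
  | k + 1 => removeBlock (iterGen k)

theorem contiguous_iterGen (k : ℕ) : Contiguous (iterGen k) := by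
  induction k with
  | zero =>
    intro u v a b
    rcases a with _ | a <;> rcases b with _ | b <;>
      simp only [iterGen, List.forall_mem_append, List.forall_mem_cons] <;> simp
  | succ k ih => exact ih.removeBlock

/-! ### The operators as sums over subsets -/

theorem sum_finset_fin_succ {A : Type*} [AddCommMonoid A] {n : ℕ}
    (F : Finset (Fin (n + 1)) → A) :
    ∑ S, F S = ∑ S : Finset (Fin n), F (S.map (Fin.succEmb n))
      + ∑ S : Finset (Fin n), F (insert 0 (S.map (Fin.succEmb n))) := by
  have h0 : (0 : Fin (n + 1)) ∉ (Finset.univ : Finset (Fin n)).map (Fin.succEmb n) := by simp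
  have hu : (Finset.univ : Finset (Finset (Fin (n + 1)))) =
      (insert 0 ((Finset.univ : Finset (Fin n)).map (Fin.succEmb n))).powerset := by
    rw [← Finset.powerset_univ, Fin.univ_succ, Finset.cons_eq_insert]
    rfl
  rw [hu, Finset.sum_powerset_insert h0]
  have hp : ((Finset.univ : Finset (Fin n)).map (Fin.succEmb n)).powerset =
      Finset.univ.map ⟨fun S : Finset (Fin n) => S.map (Fin.succEmb n),
        Finset.map_injective _⟩ := by
    ext S
    simp only [Finset.mem_powerset, Finset.mem_map, Finset.mem_univ, true_and,
      Function.Embedding.coeFn_mk, Finset.subset_map_iff]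
    simp [eq_comm]
  simp [hp]

theorem chi_map_succ {n : ℕ} (S : Finset (Fin n)) :
    chi (S.map (Fin.succEmb n)) = Fin.cons 0 (chi S) := by
  ext i
  refine Fin.cases ?_ (fun i => ?_) i <;> simp [chi]

theorem chi_insert_map_succ {n : ℕ} (S : Finset (Fin n)) :
    chi (insert 0 (S.map (Fin.succEmb n))) = Fin.cons 1 (chi S) := by
  ext i
  refine Fin.cases ?_ (fun i => ?_) i <;> simp [chi]

theorem lastBlockExponent_map_succ {n : ℕ} (a : ℕ) (α : Fin n → ℕ) (S : Finset (Fin n)) :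
    lastBlockExponent (Fin.cons a α) (S.map (Fin.succEmb n)) = lastBlockExponent α S := by
  have hmin (i : Fin n) : (S.map (Fin.succEmb n)).min < (i.succ : WithTop (Fin (n + 1))) ↔
      S.min < (i : WithTop (Fin n)) := by
    simp [Finset.min, Finset.inf_lt_iff]
  have h0 : ¬ (S.map (Fin.succEmb n)).min < ((0 : Fin (n + 1)) : WithTop (Fin (n + 1))) := by
    simp [Finset.min]
  simp only [lastBlockExponent, Finset.sum_filter, Fin.sum_univ_succ, chi_map_succ, Fin.cons_zero,
    Fin.cons_succ]
  rw [if_neg h0, zero_add]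
  exact Finset.sum_congr rfl fun i _ => if_congr (hmin i) rfl rfl

theorem lastBlockExponent_insert_map_succ {n : ℕ} (a : ℕ) (α : Fin n → ℕ) (S : Finset (Fin n)) :
    lastBlockExponent (Fin.cons a α) (insert 0 (S.map (Fin.succEmb n))) =
      ∑ i, (α i - chi S i) := by
  have hmin : (insert 0 (S.map (Fin.succEmb n))).min = ((0 : Fin (n + 1)) : WithTop _) := by
    rw [Finset.min_insert]
    refine min_eq_left ?_
    simp [Finset.min]
  simp only [lastBlockExponent, Finset.sum_filter, Fin.sum_univ_succ, chi_insert_map_succ,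
    Fin.cons_zero, Fin.cons_succ, hmin]
  rw [if_neg (lt_irrefl _), zero_add]
  exact Finset.sum_congr rfl fun i _ => if_pos (WithTop.coe_lt_coe.2 (Fin.succ_pos i))

theorem lowerSum_ofFn {n : ℕ} (α : Fin n → ℕ) (f : List ℕ → ℤ[X]) :
    lowerSum f (List.ofFn α) =
      ∑ S : Finset (Fin n) with ∀ i, chi S i ≤ α i,
        X ^ (∑ i, (α i - chi S i)) * f (List.ofFn (α - chi S)) := by
  induction n generalizing f with
  | zero => simp [lowerSum]
  | succ n ih =>
    obtain ⟨a, α, rfl⟩ : ∃ a α', α = Fin.cons a α' := ⟨_, _, (Fin.cons_self_tail α).symm⟩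
    simp only [Finset.sum_filter, sum_finset_fin_succ, chi_map_succ, chi_insert_map_succ,
      Fin.forall_fin_succ, Fin.sum_univ_succ, Fin.cons_zero, Fin.cons_succ, List.ofFn_succ,
      Pi.sub_apply] at ih ⊢
    cases a with
    | zero => simp [lowerSum, ih]; rfl
    | succ a =>
      simp only [lowerSum, ih, Finset.mul_sum]
      congr 1 <;> refine Finset.sum_congr rfl fun S _ => ?_ <;>
        simp [pow_add, mul_assoc] <;> rfl

theorem removeBlock_ofFn {n : ℕ} (α : Fin n → ℕ) (f : List ℕ → ℤ[X]) :
    removeBlock f (List.ofFn α) =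
      ∑ S : Finset (Fin n) with S.Nonempty ∧ ∀ i, chi S i ≤ α i,
        X ^ lastBlockExponent α S * f (List.ofFn (α - chi S)) := by
  induction n generalizing f with
  | zero => simp [removeBlock, Finset.eq_empty_of_isEmpty]
  | succ n ih =>
    obtain ⟨a, α, rfl⟩ : ∃ a α', α = Fin.cons a α' := ⟨_, _, (Fin.cons_self_tail α).symm⟩
    have hl := lowerSum_ofFn α
    simp only [Finset.sum_filter, sum_finset_fin_succ, chi_map_succ, chi_insert_map_succ,
      Fin.forall_fin_succ, Fin.cons_zero, Fin.cons_succ, List.ofFn_succ,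
      Pi.sub_apply, lastBlockExponent_map_succ, lastBlockExponent_insert_map_succ] at ih hl ⊢
    cases a with
    | zero => simp [removeBlock, ih]; rfl
    | succ a =>
      simp only [removeBlock, ih, hl]
      congr 1 <;> refine Finset.sum_congr rfl fun S _ => ?_ <;> simp <;> rfl


/-! ### Miniwords and maj under cyclic relabelling -/

/-- The letters of a block, listed in the cyclic order starting right after `h`. -/
def blockWord {n : ℕ} (h : Fin n) (B : Finset (Fin n)) : List (Fin n) :=
  (B.filter (fun x => h < x)).sort (· ≤ ·) ++ (B.filter (fun x => x ≤ h)).sort (· ≤ ·)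

/-- The word obtained by organizing a list of blocks from right to left, to the left of a word that
starts with `a`. -/
def wordBefore {n : ℕ} (a : Fin n) : List (Finset (Fin n)) → List (Fin n)
  | [] => []
  | B :: rest => blockWord ((wordBefore a rest).headD a) B ++ wordBefore a rest

theorem miniwordList_append_singleton {n : ℕ} (S : Finset (Fin n)) (a : Fin n) (t : List (Fin n))
    (hS : S.sort (· ≤ ·) = a :: t) (L : List (Finset (Fin n))) :
    miniwordList (L ++ [S]) = wordBefore a L ++ a :: t := by
  induction L with
  | nil => simp [miniwordList, wordBefore, hS]
  | cons B L ih =>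
    simp only [List.cons_append, miniwordList, wordBefore, ih]
    cases wordBefore a L <;> simp [blockWord]

/-- In the cyclic order starting after the largest letter, a block is simply increasing, as the last
block of a miniword must be. -/
theorem wordBefore_last {m : ℕ} (L : List (Finset (Fin (m + 1)))) :
    wordBefore (Fin.last m) L = miniwordList L := by
  induction L with
  | nil => rfl
  | cons B L ih =>
    simp only [miniwordList, wordBefore, ih]
    cases miniwordList L with
    | nil =>
      have h₁ : B.filter (fun x => Fin.last m < x) = ∅ :=
        Finset.filter_eq_empty_iff.2 fun x _ => (Fin.le_last x).not_gt
      have h₂ : B.filter (fun x => x ≤ Fin.last m) = B :=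
        Finset.filter_eq_self.2 fun x _ => Fin.le_last x
      simp [blockWord, h₁, h₂]
    | cons b w => simp [blockWord]

theorem val_sub_succ {m : ℕ} (x h : Fin (m + 1)) :
    (x - (h + 1)).val = if h < x then x.val - h.val - 1 else x.val + m - h.val := by
  have hx := x.isLt
  have hh := h.isLt
  rcases eq_or_lt_of_le (Nat.lt_succ_iff.1 hh) with e | e
  · have : h = Fin.last m := Fin.ext e
    subst this
    rw [if_neg (Fin.le_last x).not_gt]
    simp
  · have h1 : (h + 1).val = h.val + 1 := Fin.val_add_one_of_lt (by simpa [Fin.lt_def] using e)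
    rw [Fin.sub_def]
    simp only [h1, Fin.lt_def]
    split_ifs with hlt
    · rw [show m + 1 - (h.val + 1) + x.val = x.val - h.val - 1 + (m + 1) by omega,
        Nat.add_mod_right, Nat.mod_eq_of_lt (by omega)]
    · rw [Nat.mod_eq_of_lt (by omega)]
      omega

theorem coe_blockWord {n : ℕ} (h : Fin n) (B : Finset (Fin n)) :
    (blockWord h B : Multiset (Fin n)) = B.val := by
  rw [blockWord, ← Multiset.coe_add, Finset.sort_eq, Finset.sort_eq, Finset.filter_val,
    Finset.filter_val]
  simp_rw [← not_lt]
  exact Multiset.filter_add_not _ _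

theorem blockWord_pairwise {m : ℕ} (h : Fin (m + 1)) (B : Finset (Fin (m + 1))) :
    (blockWord h B).Pairwise (fun x y => x - (h + 1) < y - (h + 1)) := by
  have key (x y : Fin (m + 1)) (hxy : (x < y ∧ (h < x ∧ h < y ∨ x ≤ h ∧ y ≤ h)) ∨ h < x ∧ y ≤ h) :
      x - (h + 1) < y - (h + 1) := by
    rw [Fin.lt_def, val_sub_succ, val_sub_succ]
    simp only [Fin.lt_def, Fin.le_def] at *
    have := x.isLt
    split_ifs <;> omega
  rw [blockWord, List.pairwise_append]
  refine ⟨?_, ?_, ?_⟩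
  · refine (Finset.sortedLT_sort _).pairwise.imp_of_mem fun {x y} hx hy hxy => key x y ?_
    simp only [Finset.mem_sort, Finset.mem_filter] at hx hy
    exact Or.inl ⟨hxy, Or.inl ⟨hx.2, hy.2⟩⟩
  · refine (Finset.sortedLT_sort _).pairwise.imp_of_mem fun {x y} hx hy hxy => key x y ?_
    simp only [Finset.mem_sort, Finset.mem_filter] at hx hy
    exact Or.inl ⟨hxy, Or.inr ⟨hx.2, hy.2⟩⟩
  · intro x hx y hy
    simp only [Finset.mem_sort, Finset.mem_filter] at hx hy
    exact key x y (Or.inr ⟨hx.2, hy.2⟩)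

/-- A block word is sorted for the cyclic order starting after `h`, and rotation carries this order
to the one starting after `h - c`; sorted lists with equal content agree. -/
theorem blockWord_map_sub {m : ℕ} (c h : Fin (m + 1)) (B : Finset (Fin (m + 1))) :
    blockWord (h - c) (B.map (Equiv.subRight c).toEmbedding) = (blockWord h B).map (· - c) := by
  refine List.Perm.eq_of_pairwise
    (le := fun x y => x - (h - c + 1) < y - (h - c + 1)) ?_ (blockWord_pairwise _ _) ?_ ?_
  · intro x y _ _ hxy hyx
    exact absurd hyx hxy.not_gt
  · rw [List.pairwise_map]
    refine (blockWord_pairwise h B).imp fun {x y} hxy => ?_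
    convert hxy using 1 <;> abel
  · rw [← Multiset.coe_eq_coe, coe_blockWord, ← Multiset.map_coe, coe_blockWord]
    rfl

theorem wordBefore_map_sub {m : ℕ} (c a : Fin (m + 1)) (L : List (Finset (Fin (m + 1)))) :
    wordBefore (a - c) (L.map fun B => B.map (Equiv.subRight c).toEmbedding) =
      (wordBefore a L).map (· - c) := by
  induction L with
  | nil => rfl
  | cons B L ih =>
    simp only [List.map_cons, wordBefore, ih, List.map_append, ← blockWord_map_sub]
    cases wordBefore a L <;> rfl

theorem countP_wordBefore {n : ℕ} (a : Fin n) (p : Fin n → Prop) [DecidablePred p]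
    (L : List (Finset (Fin n))) :
    (wordBefore a L).countP p = (L.map fun B => (B.filter p).card).sum := by
  induction L with
  | nil => rfl
  | cons B L ih =>
    have h := congrArg (Multiset.countP p) (coe_blockWord ((wordBefore a L).headD a) B)
    rw [Multiset.coe_countP, Multiset.countP_eq_card_filter, ← Finset.filter_val] at h
    simp only [wordBefore, List.countP_append, ih, List.map_cons, List.sum_cons, h]
    rfl

theorem majWord_eq_sum_range {m : ℕ} (w : List (Fin (m + 1))) :
    majWord w = ∑ i ∈ Finset.range (w.length - 1),
      if w.getD (i + 1) 0 < w.getD i 0 then i + 1 else 0 := by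
  rw [← Fin.sum_univ_eq_sum_range
    (fun i => if w.getD (i + 1) 0 < w.getD i 0 then i + 1 else 0)]
  refine Finset.sum_congr rfl fun i _ => ?_
  rw [List.getD_eq_getElem _ _ (show i.val + 1 < w.length by omega),
    List.getD_eq_getElem _ _ (show i.val < w.length by omega)]
  rfl

theorem majWord_singleton {n : ℕ} (x : Fin n) : majWord [x] = 0 := rfl

theorem majWord_concat {m : ℕ} (w : List (Fin (m + 1))) (x y : Fin (m + 1)) :
    majWord (w ++ [x] ++ [y]) = majWord (w ++ [x]) + if y < x then w.length + 1 else 0 := by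
  rw [majWord_eq_sum_range, majWord_eq_sum_range]
  simp only [List.length_append, List.length_singleton, Nat.add_sub_cancel,
    Finset.sum_range_succ]
  congr 1
  · refine Finset.sum_congr rfl fun i hi => ?_
    have hi := Finset.mem_range.1 hi
    rw [List.getD_append (w ++ [x]) [y] 0 (i + 1) (by simp; omega),
      List.getD_append (w ++ [x]) [y] 0 i (by simp; omega)]
  · have h₁ : (w ++ [x] ++ [y]).getD (w.length + 1) 0 = y := by simp
    have h₂ : (w ++ [x] ++ [y]).getD w.length 0 = x := by simp
    rw [h₁, h₂]

theorem majWord_append_sorted {m : ℕ} (w t : List (Fin (m + 1))) (a : Fin (m + 1))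
    (ht : (a :: t).Pairwise (· ≤ ·)) : majWord (w ++ a :: t) = majWord (w ++ [a]) := by
  induction t using List.reverseRecOn with
  | nil => rfl
  | append_singleton t y ih =>
    rw [← List.cons_append, List.pairwise_append] at ht
    rw [← ih ht.1]
    rcases List.eq_nil_or_concat' (a :: t) with h | ⟨u, x, h⟩
    · simp at h
    · have hx : x ≤ y := ht.2.2 x (by simp [h]) y (by simp)
      rw [← List.cons_append, h, ← List.append_assoc, ← List.append_assoc, majWord_concat,
        if_neg hx.not_gt, add_zero]

/-- Relabelling keeps the order within the classes `> a` and `≤ a` and exchanges the classes. A step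
from `> a` to `≤ a` is a descent only before relabelling, a reverse step only after. So each maximal
run of letters `> a` contributes its end position minus the position before its start, which is its
length; the `if` term closes a run that reaches the end. -/
theorem majWord_add_last {m : ℕ} (a : Fin (m + 1)) (w : List (Fin (m + 1))) (x : Fin (m + 1)) :
    majWord (w ++ [x]) + (if a < x then w.length + 1 else 0) =
      (w ++ [x]).countP (fun y => a < y) + majWord ((w ++ [x]).map (· - (a + 1))) := by
  induction w using List.reverseRecOn generalizing x with
  | nil => by_cases h : a < x <;> simp [h, majWord_singleton]
  | append_singleton w z ih =>
    have hz := ih z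
    have hxz : x - (a + 1) < z - (a + 1) ↔
        ((a < x ↔ a < z) ∧ x < z) ∨ (a < x ∧ z ≤ a) := by
      rw [Fin.lt_def, val_sub_succ, val_sub_succ]
      have := x.isLt
      have := z.isLt
      simp only [Fin.lt_def, Fin.le_def] at *
      split_ifs <;> omega
    rw [majWord_concat, List.map_append, List.map_append, List.map_singleton, List.map_singleton,
      majWord_concat, List.countP_append]
    rw [List.map_append, List.map_singleton] at hz
    simp only [List.length_append, List.length_singleton, List.length_map, List.countP_singleton,
      hxz, decide_eq_true_eq]
    simp only [Fin.lt_def, Fin.le_def] at *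
    split_ifs at * <;> omega

theorem majWord_append_singleton {m : ℕ} (a : Fin (m + 1)) (w : List (Fin (m + 1))) :
    majWord (w ++ [a]) =
      w.countP (fun y => a < y) + majWord (w.map (· - (a + 1))) := by
  rcases List.eq_nil_or_concat' w with rfl | ⟨u, x, rfl⟩
  · rfl
  · rw [majWord_concat, majWord_add_last]

/-- The relabelling of an ordered multiset partition obtained by subtracting `c` from all
letters. -/
def shift {m k : ℕ} (c : Fin (m + 1)) (π : Fin k → Finset (Fin (m + 1))) :
    Fin k → Finset (Fin (m + 1)) :=
  fun i => (π i).map (Equiv.subRight c).toEmbedding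

theorem minimaj_snoc {m k : ℕ} (π : Fin k → Finset (Fin (m + 1))) (S : Finset (Fin (m + 1)))
    (hS : S.Nonempty) :
    minimaj (Fin.snoc π S : Fin (k + 1) → Finset (Fin (m + 1))) =
      ∑ i, ((π i).filter (fun x => S.min' hS < x)).card + minimaj (shift (S.min' hS + 1) π) := by
  obtain ⟨a, t, hat⟩ : ∃ a t, S.sort (· ≤ ·) = a :: t := by
    rcases h : S.sort (· ≤ ·) with _ | ⟨a, t⟩
    · have := S.length_sort (· ≤ ·)
      rw [h] at this
      exact absurd this.symm hS.card_pos.ne'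
    · exact ⟨a, t, rfl⟩
  have ha : S.min' hS = a := by
    rw [Finset.min'_eq_sorted_zero]
    simp [hat]
  have hw : miniword (Fin.snoc π S : Fin (k + 1) → Finset (Fin (m + 1))) =
      wordBefore a (List.ofFn π) ++ a :: t := by
    rw [miniword, List.ofFn_succ', List.concat_eq_append]
    simp only [Fin.snoc_castSucc, Fin.snoc_last]
    exact miniwordList_append_singleton S a t hat _
  have hs : miniword (shift (a + 1) π) = (wordBefore a (List.ofFn π)).map (· - (a + 1)) := by
    rw [← wordBefore_map_sub, miniword, ← wordBefore_last, List.map_ofFn]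
    congr 1
    -- The relabelling sends `a` to `-1`, the largest letter, so `wordBefore_last` applies.
    rw [sub_add_cancel_left, eq_neg_iff_add_eq_zero]
    simp
  rw [ha, minimaj, minimaj, hw, hs, majWord_append_sorted, majWord_append_singleton,
    countP_wordBefore, List.map_ofFn, List.sum_ofFn]
  · rfl
  · rw [← hat]
    exact S.pairwise_sort (· ≤ ·)


/-! ### Contents and removal of the last block -/

/-- All blocks are nonempty and `α x` blocks contain the letter `x`. -/
def HasContent {n k : ℕ} (α : Fin n → ℕ) (π : Fin k → Finset (Fin n)) : Prop :=
  (∀ i, (π i).Nonempty) ∧ ∑ i, chi (π i) = α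

instance {n k : ℕ} (α : Fin n → ℕ) : DecidablePred (HasContent (k := k) α) := fun π => by
  unfold HasContent
  infer_instance

theorem isPartitionAll_iff {m k : ℕ} (r : ℕ) (β : Fin m → ℕ) (π : Fin k → Finset (Fin (m + 1))) :
    IsPartitionAll r β π ↔ HasContent (Fin.cons r β) π := by
  have hl (x : Fin (m + 1)) : (∑ i, (π i).val).count x = (∑ i, chi (π i)) x := by
    rw [Multiset.count_sum', Finset.sum_apply]
    exact Finset.sum_congr rfl fun i _ => Multiset.count_eq_of_nodup (π i).nodup
  have hr (x : Fin (m + 1)) :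
      (multisetA r β).count x = (Fin.cons r β : Fin (m + 1) → ℕ) x := by
    rw [multisetA, Multiset.count_add, Multiset.count_sum']
    refine Fin.cases ?_ (fun j => ?_) x
    · simp [Multiset.count_replicate, Fin.succ_ne_zero]
    · simp [Multiset.count_replicate, (Fin.succ_ne_zero j).symm]
  unfold IsPartitionAll HasContent
  rw [Multiset.ext, funext_iff]
  simp only [hl, hr]

theorem hasContent_snoc {n k : ℕ} (α : Fin n → ℕ) (π : Fin k → Finset (Fin n))
    (S : Finset (Fin n)) :
    HasContent α (Fin.snoc π S : Fin (k + 1) → Finset (Fin n)) ↔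
      (S.Nonempty ∧ ∀ i, chi S i ≤ α i) ∧ HasContent (α - chi S) π := by
  unfold HasContent
  simp only [Fin.forall_fin_succ', Fin.sum_univ_castSucc, Fin.snoc_castSucc, Fin.snoc_last]
  constructor
  · rintro ⟨⟨h₁, h₂⟩, rfl⟩
    exact ⟨⟨h₂, fun i => Nat.le_add_left _ _⟩, h₁, (add_tsub_cancel_right _ _).symm⟩
  · rintro ⟨⟨h₁, h₂⟩, h₃, h₄⟩
    exact ⟨⟨h₃, h₁⟩, by rw [h₄]; exact tsub_add_cancel_of_le h₂⟩

theorem sum_snoc {A : Type*} [AddCommMonoid A] {n k : ℕ} (α : Fin n → ℕ)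
    (p : Finset (Fin n) → Prop) [DecidablePred p] (F : (Fin (k + 1) → Finset (Fin n)) → A) :
    ∑ π with HasContent α π ∧ p (π (Fin.last k)), F π =
      ∑ S with (S.Nonempty ∧ ∀ i, chi S i ≤ α i) ∧ p S,
        ∑ π : Fin k → Finset (Fin n) with HasContent (α - chi S) π, F (Fin.snoc π S) := by
  simp only [Finset.sum_filter]
  rw [← (Fin.snocEquiv fun _ => Finset (Fin n)).sum_comp, Fintype.sum_prod_type]
  refine Finset.sum_congr rfl fun S _ => ?_
  have hs (π : Fin k → Finset (Fin n)) :
      Fin.snocEquiv (fun _ => Finset (Fin n)) (S, π) = Fin.snoc π S := rfl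
  simp only [hs, hasContent_snoc, Fin.snoc_last]
  by_cases h : S.Nonempty ∧ ∀ i, chi S i ≤ α i <;> by_cases h' : p S <;> simp [h, h']

theorem lastBlockExponent_of_hasContent {n k : ℕ} {α : Fin n → ℕ} {S : Finset (Fin n)}
    (hS : S.Nonempty) {π : Fin k → Finset (Fin n)} (hπ : HasContent (α - chi S) π) :
    lastBlockExponent α S = ∑ i, ((π i).filter (fun x => S.min' hS < x)).card := by
  have h (x : Fin n) : α x - chi S x = ∑ i, chi (π i) x := by
    rw [← Finset.sum_apply, hπ.2]; rfl
  simp only [lastBlockExponent, h]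
  rw [Finset.sum_comm]
  refine Finset.sum_congr rfl fun i _ => ?_
  simp only [← Finset.coe_min' hS, WithTop.coe_lt_coe, chi, Finset.card_filter, Finset.sum_filter]
  rw [← Finset.sum_filter, ← Finset.sum_filter, ← Finset.sum_filter, Finset.filter_comm]
  simp

/-- The last block lies to the left of no other, and can supply only its minimum as the smaller
entry of a pair. -/
theorem inv_snoc {n k : ℕ} (π : Fin k → Finset (Fin n)) (S : Finset (Fin n))
    (hS : S.Nonempty) :
    inv (Fin.snoc π S : Fin (k + 1) → Finset (Fin n)) =
      ∑ i, ((π i).filter (fun x => S.min' hS < x)).card + inv π := by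
  have hmin (y : Fin n) : S.min = (y : WithTop (Fin n)) ↔ y = S.min' hS := by
    rw [← Finset.coe_min' hS, WithTop.coe_inj, eq_comm]
  have hlast (i : Fin k) : ¬ Fin.last k < i.castSucc := (Fin.le_last _).not_gt
  simp only [inv, Finset.card_filter, Fintype.sum_prod_type, Fin.sum_univ_castSucc,
    Fin.snoc_castSucc, Fin.snoc_last, Fin.castSucc_lt_castSucc_iff, Fin.castSucc_lt_last, hmin,
    hlast, lt_irrefl, false_and, if_false, true_and, Finset.sum_const_zero, add_zero]
  simp only [Finset.sum_add_distrib]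
  rw [add_comm]
  congr 1
  refine Finset.sum_congr rfl fun i _ => ?_
  rw [← Finset.sum_filter_of_ne (s := Finset.univ) (p := (· ∈ π i)), Finset.filter_univ_mem]
  · refine Finset.sum_congr rfl fun x hx => ?_
    rw [Finset.sum_eq_single (S.min' hS)]
    · simp [hx]
    · intro y _ hy
      simp [hy]
    · simp
  · intro x _ hx
    by_contra hxi
    simp [hxi] at hx

/-! ### Symmetry of the minimaj generating function -/

/-- The generating function of minimaj over the ordered multiset partitions of content `α`. -/
noncomputable def minimajGen {n : ℕ} (α : Fin n → ℕ) (k : ℕ) : ℕ[X] :=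
  ∑ π : Fin k → Finset (Fin n) with HasContent α π, X ^ minimaj π

theorem hasContent_shift {m k : ℕ} (α : Fin (m + 1) → ℕ) (c : Fin (m + 1))
    (π : Fin k → Finset (Fin (m + 1))) :
    HasContent (fun x => α (x + c)) (shift c π) ↔ HasContent α π := by
  have h (x : Fin (m + 1)) (i : Fin k) : chi (shift c π i) x = chi (π i) (x + c) := by
    simp [chi, shift]
  unfold HasContent
  simp only [funext_iff, Finset.sum_apply, h]
  simp only [shift, Finset.map_nonempty]
  refine and_congr_right fun _ => ?_
  exact (Equiv.addRight c).forall_congr_right (q := fun x => ∑ i, chi (π i) x = α x)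

theorem sum_minimaj_shift {m k : ℕ} (α : Fin (m + 1) → ℕ) (c : Fin (m + 1)) :
    ∑ π : Fin k → Finset (Fin (m + 1)) with HasContent α π, (X : ℕ[X]) ^ minimaj (shift c π) =
      minimajGen (fun x => α (x + c)) k := by
  let e : (Fin k → Finset (Fin (m + 1))) ≃ (Fin k → Finset (Fin (m + 1))) :=
    Equiv.piCongrRight fun _ => (Equiv.subRight c).finsetCongr
  rw [minimajGen, Finset.sum_filter, Finset.sum_filter, ← e.sum_comp (M := ℕ[X])
    (fun π => if HasContent (fun x => α (x + c)) π then X ^ minimaj π else 0)]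
  refine Finset.sum_congr rfl fun π _ => ?_
  exact if_congr (hasContent_shift α c π).symm rfl rfl

theorem sum_minimaj_filter {m k : ℕ} (α : Fin (m + 1) → ℕ) (p : Finset (Fin (m + 1)) → Prop)
    [DecidablePred p]
    (hk : ∀ (α : Fin (m + 1) → ℕ) (c : Fin (m + 1)),
      minimajGen (fun x => α (x + c)) k = minimajGen α k) :
    ∑ π : Fin (k + 1) → Finset (Fin (m + 1)) with HasContent α π ∧ p (π (Fin.last k)),
        (X : ℕ[X]) ^ minimaj π =
      ∑ S with (S.Nonempty ∧ ∀ i, chi S i ≤ α i) ∧ p S,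
        X ^ lastBlockExponent α S * minimajGen (α - chi S) k := by
  rw [sum_snoc]
  refine Finset.sum_congr rfl fun S hS => ?_
  have hne := (Finset.mem_filter.1 hS).2.1.1
  -- Rotation invariance undoes the relabelling, whose amount depends on `S`.
  rw [← hk (α - chi S) (S.min' hne + 1), ← sum_minimaj_shift, Finset.mul_sum]
  refine Finset.sum_congr rfl fun π hπ => ?_
  rw [minimaj_snoc π S hne, pow_add,
    lastBlockExponent_of_hasContent hne (Finset.mem_filter.1 hπ).2]

/-- Rotating the multiplicities permutes the list, and `iterGen k` is symmetric. -/
theorem minimajGen_rotate {m k : ℕ} (h : ∀ α : Fin (m + 1) → ℕ,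
      (minimajGen α k).map (Nat.castRingHom ℤ) = iterGen k (List.ofFn α))
    (α : Fin (m + 1) → ℕ) (c : Fin (m + 1)) :
    minimajGen (fun x => α (x + c)) k = minimajGen α k := by
  refine Polynomial.map_injective (Nat.castRingHom ℤ) Nat.cast_injective ?_
  rw [h, h]
  exact Contiguous.perm ((Equiv.addRight c).ofFn_comp_perm α) (contiguous_iterGen k)

theorem map_minimajGen {m : ℕ} (k : ℕ) : ∀ α : Fin (m + 1) → ℕ,
    (minimajGen α k).map (Nat.castRingHom ℤ) = iterGen k (List.ofFn α) := by
  induction k with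
  | zero =>
    intro α
    have h0 : (∀ a ∈ List.ofFn α, a = 0) ↔ 0 = α := by
      rw [List.forall_mem_ofFn_iff, funext_iff]
      exact forall_congr' fun _ => eq_comm
    have hm (π : Fin 0 → Finset (Fin (m + 1))) : minimaj π = 0 := rfl
    simp only [minimajGen, iterGen, h0, HasContent, hm]
    by_cases h : 0 = α <;> simp [h]
  | succ k ih =>
    intro α
    have h := sum_minimaj_filter α (fun _ => True) (minimajGen_rotate ih)
    simp only [and_true] at h
    rw [minimajGen, h, iterGen, removeBlock_ofFn, Polynomial.map_sum]
    refine Finset.sum_congr rfl fun S _ => ?_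
    rw [Polynomial.map_mul, ih, Polynomial.map_pow, Polynomial.map_X]

/-- Last blocks avoiding `0` correspond to subsets of `[m]`; the multiplicity of `0` stays untouched
and, as `0` is the least letter, never enters the exponent. -/
theorem sum_zero_notMem {A : Type*} [AddCommMonoid A] {m : ℕ} (r : ℕ) (β : Fin m → ℕ)
    (F : ℕ → (Fin (m + 1) → ℕ) → A) :
    ∑ S : Finset (Fin (m + 1)) with
        (S.Nonempty ∧ ∀ i, chi S i ≤ (Fin.cons r β : Fin (m + 1) → ℕ) i) ∧ 0 ∉ S,
      F (lastBlockExponent (Fin.cons r β) S) (Fin.cons r β - chi S) =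
    ∑ S : Finset (Fin m) with S.Nonempty ∧ ∀ i, chi S i ≤ β i,
      F (lastBlockExponent β S) (Fin.cons r (β - chi S)) := by
  have hsub (S : Finset (Fin m)) : (Fin.cons r β : Fin (m + 1) → ℕ) - Fin.cons 0 (chi S) =
      Fin.cons r (β - chi S) := by
    ext i
    refine Fin.cases ?_ (fun i => ?_) i <;> simp
  simp only [Finset.sum_filter, sum_finset_fin_succ, chi_map_succ, Fin.forall_fin_succ,
    Fin.cons_zero, Fin.cons_succ, lastBlockExponent_map_succ, hsub]
  simp

theorem isPartition_iff {m k : ℕ} (r : ℕ) (β : Fin m → ℕ)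
    (π : Fin (k + 1) → Finset (Fin (m + 1))) :
    IsPartition r β π ↔ HasContent (Fin.cons r β) π ∧ 0 ∉ π (Fin.last k) := by
  rw [IsPartition, isPartitionAll_iff]
  refine and_congr_right fun _ => ⟨fun h => h _ rfl, fun h i hi => ?_⟩
  rwa [show i = Fin.last k from Fin.ext (Nat.succ_injective hi)]

end OMP

theorem mainTheorem6 (m r k : ℕ) (hk : 1 ≤ k) (β : Fin m → ℕ) :
    OMP.M r β k =
      ∑ S : Finset (Fin m) with S.Nonempty ∧ (∀ i, OMP.chi S i ≤ β i),
        Polynomial.X ^ OMP.lastBlockExponent β S * OMP.Mall r (β - OMP.chi S) (k - 1) ∧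
    OMP.I r β k =
      ∑ S : Finset (Fin m) with S.Nonempty ∧ (∀ i, OMP.chi S i ≤ β i),
        Polynomial.X ^ OMP.lastBlockExponent β S * OMP.Iall r (β - OMP.chi S) (k - 1) := by
  obtain ⟨k, rfl⟩ := Nat.exists_eq_add_of_le' hk
  rw [Nat.add_sub_cancel]
  constructor
  · simp only [OMP.M, OMP.Mall, OMP.isPartition_iff, OMP.isPartitionAll_iff]
    rw [OMP.sum_minimaj_filter _ (fun S => 0 ∉ S) (OMP.minimajGen_rotate (OMP.map_minimajGen k))]
    exact OMP.sum_zero_notMem r β fun e γ => X ^ e * OMP.minimajGen γ k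
  · simp only [OMP.I, OMP.Iall, OMP.isPartition_iff, OMP.isPartitionAll_iff]
    rw [OMP.sum_snoc _ (fun S => 0 ∉ S), ← OMP.sum_zero_notMem r β fun e γ => X ^ e *
      ∑ π : Fin k → Finset (Fin (m + 1)) with OMP.HasContent γ π, X ^ OMP.inv π]
    refine Finset.sum_congr rfl fun S hS => ?_
    have hne := (Finset.mem_filter.1 hS).2.1.1
    rw [Finset.mul_sum]
    refine Finset.sum_congr rfl fun π hπ => ?_
    rw [OMP.inv_snoc π S hne, pow_add,
      OMP.lastBlockExponent_of_hasContent hne (Finset.mem_filter.1 hπ).2]
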